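/- Let $p$ be a prime, $n\ge 1$, let $E$ be a Hausdorff, sequentially complete topological vector space over $\mathbb{Q}_p$ which is locally convex (the open $\mathbb{Z}_p$-submodules form a basis of $0$-neighbourhoods), and let $f\colon \mathbb{Z}_p^n\to E$ be continuous. For $\nu\in\mathbb{N}_0^n$ let $|\nu|:=\nu_1+\cdots+\nu_n$ and let $$a_\nu:=\sum_{\mu\le\nu}(-1)^{|\nu|-|\mu|}\binom{\nu}{\mu}f(\mu)\in E,\qquad \binom{\nu}{\mu}:=\prod_{i=1}^n\binom{\nu_i}{\mu_i},$$ be the Mahler coefficients of $f$. For $\beta\in\mathbb{N}_0^n$ and $x=(x^{(i)}_j)_{1\le i\le n,\,0\le j\le\beta_i}\in\prod_{i=1}^n\mathbb{Z}_p^{1+\beta_i}$ such that $x^{(i)}_j\ne x^{(i)}_k$ for all $i$ and all $j\neq k$, put $$f^{>\beta<}(x):=\sum_{j_1=0}^{\beta_1}\cdots\sum_{j_n=0}^{\beta_n}\Bigl(\prod_{i=1}^n\prod_{k\ne j_i}\frac{1}{x^{(i)}_{j_i}-x^{(i)}_{k}}\Bigr)f\bigl(x^{(1)}_{j_1},\ldots,x^{(n)}_{j_n}\bigr).$$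 For $\alpha\in\mathbb{N}_0^n$, the map $f$ is called $C^\alpha$ if, for every $\beta\in\mathbb{N}_0^n$ with $\beta\le\alpha$ (componentwise), $f^{>\beta<}$ extends to a continuous map $\prod_{i=1}^n\mathbb{Z}_p^{1+\beta_i}\to E$. For $r\in\mathbb{N}_0$, $f$ is called $C^r$ if it is $C^\alpha$ for all $\alpha\in\mathbb{N}_0^n$ with $|\alpha|\le r$. Then: (i) $f(x)=\sum_{\nu\in\mathbb{N}_0^n}\binom{x}{\nu}a_\nu$ for all $x\in\mathbb{Z}_p^n$ (convergence of the net of finite partial sums), where $\binom{x}{\nu}:=\prod_{i=1}^n\binom{x_i}{\nu_i}$. (ii) For each $\alpha\in\mathbb{N}_0^n$, $f$ is $C^\alpha$ if and only if, for each continuous ultrametric seminorm $q$ on $E$, $$q(a_\nu)\,w_\alpha(\nu)\to 0\quad\text{as } |\nu|\to\infty,\qquad\text{where } w_\alpha(\nu):=\prod_{i=1}^n\max\{\nu_i,1\}^{\alpha_i}$$ (that is, $w_\alpha(\nu)=\nu^\alpha=\nu_1^{\alpha_1}\cdots\nu_n^{\alpha_n}$, with entries $\nu_i=0$ replaced by $1$).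 (iii) For each $r\in\mathbb{N}_0$, $f$ is $C^r$ if and only if $q(a_\nu)\,|\nu|^r\to 0$ as $|\nu|\to\infty$, for each continuous ultrametric seminorm $q$ on $E$. -/

import Mathlib

open Filter Topology

noncomputable section

/-- A topological vector space over `ℚ_p` is locally convex if the open `ℤ_p`-submodules form a
basis of neighbourhoods of `0` (each open submodule contains `0`, hence is a neighbourhood of `0`). -/
def IsLocallyConvexPadic (p : ℕ) [Fact p.Prime] (E : Type*) [AddCommGroup E] [Module ℚ_[p] E]
    [TopologicalSpace E] : Prop :=
  ∀ W ∈ 𝓝 (0 : E), ∃ N : Submodule (PadicInt.subring p) E, IsOpen (N : Set E) ∧ (N : Set E) ⊆ W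

/-- For `U = ℤ_p^n`, a subset of `ℚ_p^n`, the domain `U^{<β>} = ∏ i, ℤ_p^{1 + β i}`; a point is
`x = (x i j)` with `i < n` and `0 ≤ j ≤ β i`. -/
abbrev DiffQuotDomain (p : ℕ) [Fact p.Prime] {n : ℕ} (β : Fin n → ℕ) : Type :=
  ∀ i : Fin n, Fin (β i + 1) → ℤ_[p]

/-- The set `U^{>β<}` of all points `x` of `U^{<β>}` such that `x i j ≠ x i k` for all `i`
and all `j < k`. -/
def diffQuotSet (p : ℕ) [Fact p.Prime] {n : ℕ} (β : Fin n → ℕ) : Set (DiffQuotDomain p β) :=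
  {x | ∀ i : Fin n, ∀ j k : Fin (β i + 1), j < k → x i j ≠ x i k}

/-- The iterated partial difference quotient `f^{>β<}`, meaningful on `diffQuotSet p β`:
the sum over all `(j_1, …, j_n)` of
`(∏ i, ∏ k ≠ j_i, 1 / (x i j_i - x i k)) • f (x 1 j_1, …, x n j_n)`, with scalars in `ℚ_p`. -/
def diffQuot {p : ℕ} [Fact p.Prime] {n : ℕ} {E : Type*} [AddCommGroup E] [Module ℚ_[p] E]
    (f : (Fin n → ℤ_[p]) → E) (β : Fin n → ℕ) (x : DiffQuotDomain p β) : E :=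
  ∑ j : (∀ i : Fin n, Fin (β i + 1)),
    (∏ i, ∏ k ∈ Finset.univ.erase (j i), ((x i (j i) : ℚ_[p]) - (x i k : ℚ_[p]))⁻¹) •
      f (fun i => x i (j i))

/-- `f : ℤ_p^n → E` is `C^α` if, for each `β ≤ α`, the map `f^{>β<}` on `U^{>β<}` has a continuous
extension `f^{<β>}` to `U^{<β>}`. -/
def IsCAlpha {p : ℕ} [Fact p.Prime] {n : ℕ} {E : Type*} [AddCommGroup E] [Module ℚ_[p] E]
    [TopologicalSpace E] (α : Fin n → ℕ) (f : (Fin n → ℤ_[p]) → E) : Prop :=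
  ∀ β : Fin n → ℕ, β ≤ α →
    ∃ g : DiffQuotDomain p β → E, Continuous g ∧ Set.EqOn g (diffQuot f β) (diffQuotSet p β)

/-- `f : ℤ_p^n → E` is `C^r` if it is `C^α` for all multi-indices `α` with `|α| ≤ r`. -/
def IsCr {p : ℕ} [Fact p.Prime] {n : ℕ} {E : Type*} [AddCommGroup E] [Module ℚ_[p] E]
    [TopologicalSpace E] (r : ℕ) (f : (Fin n → ℤ_[p]) → E) : Prop :=
  ∀ α : Fin n → ℕ, ∑ i, α i ≤ r → IsCAlpha α f

/-- The Mahler coefficient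
`a_ν = ∑_{μ ≤ ν} (-1)^{|ν| - |μ|} (ν choose μ) f(μ)` of `f : ℤ_p^n → E`. -/
def mahlerCoeff {p : ℕ} [Fact p.Prime] {n : ℕ} {E : Type*} [AddCommGroup E]
    (f : (Fin n → ℤ_[p]) → E) (ν : Fin n → ℕ) : E :=
  ∑ μ ∈ Finset.Iic ν,
    ((-1 : ℤ) ^ (∑ i, ν i - ∑ i, μ i) * ∏ i, ((ν i).choose (μ i) : ℤ)) •
      f (fun i => (μ i : ℤ_[p]))

/-- The binomial function `(x choose ν) = ∏ i, (x i choose ν i)` on `ℤ_p^n`, which takes values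
in `ℤ_p`. -/
def multiChoose {p : ℕ} [Fact p.Prime] {n : ℕ} (x : Fin n → ℤ_[p]) (ν : Fin n → ℕ) : ℤ_[p] :=
  ∏ i, Ring.choose (x i) (ν i)

/-- The weight `ν^α = ∏ i, (ν i)^(α i)`, with vanishing entries `ν i` replaced by `1`, so that it
is positive everywhere. -/
def multiWeight {n : ℕ} (α ν : Fin n → ℕ) : ℝ :=
  ∏ i, ((max (ν i) 1 : ℕ) : ℝ) ^ α i

/-- The filter `|ν| → ∞` on multi-indices, with `|ν| = ν_1 + ⋯ + ν_n`. -/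
def absAtTop (n : ℕ) : Filter (Fin n → ℕ) :=
  comap (fun ν => ∑ i, ν i) atTop

end

/-! On `ℕ^n` every function is the sum of its Newton series, a finite sum at each point. If `f` is
continuous, its coefficients tend to zero: up to a uniformly small error, `f` is a finite
combination of products of indicators of residue classes, and these are handled by the one-variable
Mahler theorem. The error stays small because Newton coefficients are integer combinations of values
and `q` is ultrametric (`tendsto_seminorm_newtonCoeff`). Hence the Mahler series converges
uniformly, and it agrees with `f` on the dense set `ℕ^n`.

For (ii), difference quotients act on the series termwise and factor over the coordinates. The
`j`-th divided difference of `(· choose k)` extends to a continuous function bounded by `max k 1 ^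
j` (`norm_chooseDividedDiff_le`), so decay of the weighted coefficients gives a convergent series
for the extension. Conversely, the extension is read in the coordinates of `stepPoints`. There a
suitable Newton coefficient of it is a scalar multiple of a single `a_ν`
(`newtonCoeff_diffQuot_stepPoints`), and steering the denominators to powers of `p` makes that
scalar as large as the weight up to a constant (`exists_stepCoeff_ge`). Decay of the Newton
coefficients of the extension is then decay of the weighted `a_ν`.

Part (iii) compares `|ν|^r` with the weights for `|α| ≤ r`. -/

/-! ### Newton interpolation on `ℕ^ι`. -/

/-- The integer `(-1) ^ (m - k) * (m choose k)`, which vanishes for `k > m`. -/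
def newtonKernel (m k : ℕ) : ℤ := (-1) ^ (m - k) * (m.choose k : ℤ)

lemma newtonKernel_eq_zero {m k : ℕ} (h : m < k) : newtonKernel m k = 0 := by
  simp [newtonKernel, Nat.choose_eq_zero_of_lt h]

lemma fwdDiff_iter_zero_eq_sum_newtonKernel {G : Type*} [AddCommGroup G] (φ : ℕ → G) (m : ℕ) :
    (fwdDiff 1)^[m] φ 0 = ∑ k ∈ Finset.range (m + 1), newtonKernel m k • φ k := by
  rw [fwdDiff_iter_eq_sum_shift]
  simp [newtonKernel]

lemma sum_newtonKernel_mul_choose (m j : ℕ) :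
    ∑ k ∈ Finset.range (m + 1), newtonKernel m k * (k.choose j : ℤ) = if m = j then 1 else 0 := by
  have := fwdDiff_iter_zero_eq_sum_newtonKernel (fun k : ℕ => (k.choose j : ℤ)) m
  simp only [smul_eq_mul] at this
  rw [← this, fwdDiff_iter_choose_zero]

/-- This is the Newton expansion of the indicator of `j`, evaluated at `m`. -/
lemma sum_choose_mul_newtonKernel (m j : ℕ) :
    ∑ k ∈ Finset.range (m + 1), (m.choose k : ℤ) * newtonKernel k j = if m = j then 1 else 0 := by
  have h := shift_eq_sum_fwdDiff_iter 1 (fun i : ℕ => if i = j then (1 : ℤ) else 0) m 0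
  simp only [zero_add, smul_eq_mul, mul_one] at h
  rw [h]
  refine Finset.sum_congr rfl fun k _ => ?_
  rw [fwdDiff_iter_zero_eq_sum_newtonKernel]
  simp only [smul_eq_mul, mul_ite, mul_one, mul_zero, Finset.sum_ite_eq', Finset.mem_range,
    nsmul_eq_mul]
  split_ifs with hk
  · rfl
  · rw [newtonKernel_eq_zero (by lia), mul_zero]

/-- The box of all multi-indices `μ ≤ ν`. -/
def indexBox {ι : Type*} [Fintype ι] [DecidableEq ι] (ν : ι → ℕ) : Finset (ι → ℕ) :=
  Fintype.piFinset fun i => Finset.range (ν i + 1)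

lemma mem_indexBox {ι : Type*} [Fintype ι] [DecidableEq ι] {μ ν : ι → ℕ} :
    μ ∈ indexBox ν ↔ μ ≤ ν := by
  simp [indexBox, Pi.le_def]

/-- The coefficient of index `ν` in the Newton expansion of a function on `ι → ℕ`. -/
def newtonCoeff {ι E : Type*} [Fintype ι] [DecidableEq ι] [AddCommGroup E]
    (φ : (ι → ℕ) → E) (ν : ι → ℕ) : E :=
  ∑ μ ∈ indexBox ν, (∏ i, newtonKernel (ν i) (μ i)) • φ μ

lemma prod_newtonKernel_eq_zero {ι : Type*} [Fintype ι] {μ ν : ι → ℕ} (h : ¬ μ ≤ ν) :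
    ∏ i, newtonKernel (ν i) (μ i) = 0 := by
  obtain ⟨i, hi⟩ := not_forall.1 h
  exact Finset.prod_eq_zero (Finset.mem_univ i) (newtonKernel_eq_zero (by simpa using hi))

section

variable {ι E : Type*} [Fintype ι] [DecidableEq ι] [AddCommGroup E]

lemma newtonCoeff_eq_sum_of_le (φ : (ι → ℕ) → E) {ν μ : ι → ℕ} (h : ν ≤ μ) :
    newtonCoeff φ ν = ∑ l ∈ indexBox μ, (∏ i, newtonKernel (ν i) (l i)) • φ l := by
  refine Finset.sum_subset (fun l hl => mem_indexBox.2 ((mem_indexBox.1 hl).trans h)) ?_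
  intro l _ hl
  rw [prod_newtonKernel_eq_zero (fun h' => hl (mem_indexBox.2 h')), zero_smul]

/-- **Newton's interpolation formula** in several variables. -/
theorem sum_choose_smul_newtonCoeff (φ : (ι → ℕ) → E) (μ : ι → ℕ) :
    ∑ ν ∈ indexBox μ, (∏ i, ((μ i).choose (ν i) : ℤ)) • newtonCoeff φ ν = φ μ := by
  have h1 : ∀ ν ∈ indexBox μ, (∏ i, ((μ i).choose (ν i) : ℤ)) • newtonCoeff φ ν =
      ∑ l ∈ indexBox μ, (∏ i, ((μ i).choose (ν i) : ℤ) * newtonKernel (ν i) (l i)) • φ l := by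
    intro ν hν
    rw [newtonCoeff_eq_sum_of_le φ (mem_indexBox.1 hν), Finset.smul_sum]
    simp only [smul_smul, Finset.prod_mul_distrib]
  rw [Finset.sum_congr rfl h1, Finset.sum_comm]
  simp only [← Finset.sum_smul]
  -- The sum over a box of a product is a product of one-variable sums, each a Kronecker delta.
  have h2 : ∀ l : ι → ℕ, ∑ ν ∈ indexBox μ, ∏ i, ((μ i).choose (ν i) : ℤ) * newtonKernel (ν i) (l i)
      = if μ = l then 1 else 0 := by
    intro l
    rw [indexBox, ← Finset.prod_univ_sum (fun i => Finset.range (μ i + 1))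
      (fun i k => ((μ i).choose k : ℤ) * newtonKernel k (l i))]
    simp only [sum_choose_mul_newtonKernel, Finset.prod_ite_zero, Finset.prod_const_one]
    simp [funext_iff]
  simp only [h2, ite_smul, one_smul, zero_smul, Finset.sum_ite_eq]
  rw [if_pos (mem_indexBox.2 le_rfl)]

lemma newtonCoeff_prod {R : Type*} [CommRing R] (g : ι → ℕ → R) (ν : ι → ℕ) :
    newtonCoeff (fun μ => ∏ i, g i (μ i)) ν = ∏ i, (fwdDiff 1)^[ν i] (g i) 0 := by
  simp only [fwdDiff_iter_zero_eq_sum_newtonKernel, newtonCoeff, indexBox, zsmul_eq_mul,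
    Finset.prod_univ_sum, Finset.prod_mul_distrib, Int.cast_prod]

lemma newtonCoeff_add (φ ψ : (ι → ℕ) → E) (ν : ι → ℕ) :
    newtonCoeff (fun μ => φ μ + ψ μ) ν = newtonCoeff φ ν + newtonCoeff ψ ν := by
  simp [newtonCoeff, Finset.sum_add_distrib]

lemma newtonCoeff_sum {κ : Type*} (s : Finset κ) (φ : κ → (ι → ℕ) → E) (ν : ι → ℕ) :
    newtonCoeff (fun μ => ∑ c ∈ s, φ c μ) ν = ∑ c ∈ s, newtonCoeff (φ c) ν := by
  simp only [newtonCoeff, Finset.smul_sum]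
  exact Finset.sum_comm

lemma newtonCoeff_smul {R : Type*} [Ring R] [Module R E] (r : (ι → ℕ) → R) (e : E) (ν : ι → ℕ) :
    newtonCoeff (fun μ => r μ • e) ν = newtonCoeff r ν • e := by
  simp only [newtonCoeff, Finset.sum_smul]
  exact Finset.sum_congr rfl fun μ _ => (smul_assoc _ _ _).symm

/-- Newton coefficients are multiplicative on functions of separate groups of variables; this
decouples the coordinates `i` of a difference quotient. -/
lemma newtonCoeff_curry {R : Type*} [CommRing R] {κ : ι → Type*} [∀ i, Fintype (κ i)]
    [∀ i, DecidableEq (κ i)] (g : ∀ i, (κ i → ℕ) → R) (l : (Σ i, κ i) → ℕ) :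
    newtonCoeff (fun y => ∏ i, g i fun j => y ⟨i, j⟩) l =
      ∏ i, newtonCoeff (g i) fun j => l ⟨i, j⟩ := by
  simp only [newtonCoeff, zsmul_eq_mul, Finset.prod_univ_sum]
  refine Finset.sum_equiv (Equiv.piCurry fun _ _ => ℕ) ?_ ?_
  · intro y
    simp [mem_indexBox, Pi.le_def, Fintype.mem_piFinset, Sigma.forall, Sigma.curry]
  · intro y _
    simp only [Fintype.prod_sigma, Finset.prod_mul_distrib, Int.cast_prod]
    rfl

lemma newtonCoeff_cons {R : Type*} [CommRing R] {j : ℕ} (a : ℕ → R) (b : (Fin (j + 1) → ℕ) → R)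
    (l : Fin (j + 2) → ℕ) :
    newtonCoeff (fun y => a (y 0) * b (Fin.tail y)) l =
      (fwdDiff 1)^[l 0] a 0 * newtonCoeff b (Fin.tail l) := by
  simp only [newtonCoeff, fwdDiff_iter_zero_eq_sum_newtonKernel, zsmul_eq_mul,
    Finset.sum_mul_sum, ← Finset.sum_product']
  symm
  refine Finset.sum_equiv (Fin.consEquiv fun _ => ℕ) ?_ ?_
  · rintro ⟨y0, y⟩
    simp [mem_indexBox, Pi.le_def, Fin.forall_fin_succ (n := j + 1), Fin.tail]
  · rintro ⟨y0, y⟩ _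
    have h : Fin.tail (Fin.consEquiv (fun _ => ℕ) (y0, y)) = y := rfl
    rw [h]
    simp only [Fin.prod_univ_succ (n := j + 1), Fin.tail, Fin.consEquiv_apply, Fin.cons_zero,
      Fin.cons_succ]
    push_cast
    ring

/-- The values enter with integer coefficients, which have `p`-adic norm at most `1`. -/
lemma seminorm_newtonCoeff_le {p : ℕ} [Fact p.Prime] [Module ℚ_[p] E] {q : Seminorm ℚ_[p] E}
    (hq : IsNonarchimedean q) {φ : (ι → ℕ) → E} {C : ℝ} (h : ∀ μ, q (φ μ) ≤ C) (ν : ι → ℕ) :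
    q (newtonCoeff φ ν) ≤ C := by
  have hC : 0 ≤ C := (apply_nonneg q _).trans (h 0)
  refine Finset.sum_induction _ (fun e => q e ≤ C) (fun a b ha hb => (hq a b).trans (max_le ha hb))
    (by simpa using hC) fun μ _ => ?_
  rw [← Int.cast_smul_eq_zsmul ℚ_[p], map_smul_eq_mul]
  exact (mul_le_of_le_one_left (apply_nonneg q _) (Padic.norm_int_le_one _)).trans (h μ)

lemma mahlerCoeff_eq_newtonCoeff {p : ℕ} [Fact p.Prime] {n : ℕ} (f : (Fin n → ℤ_[p]) → E)
    (ν : Fin n → ℕ) :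
    mahlerCoeff f ν = newtonCoeff (fun μ => f fun i => (μ i : ℤ_[p])) ν := by
  have : Finset.Iic ν = indexBox ν := by ext; simp [mem_indexBox]
  rw [mahlerCoeff, newtonCoeff, this]
  refine Finset.sum_congr rfl fun μ hμ => ?_
  rw [mem_indexBox] at hμ
  simp only [newtonKernel, Finset.prod_mul_distrib, Finset.prod_pow_eq_pow_sum]
  rw [Finset.sum_tsub_distrib _ fun i _ => hμ i]

end

/-! ### Decay of the Newton coefficients of continuous functions. -/

/-- As all factors are at most `1`, a product `≥ ε` forces each factor to be `≥ ε`, which leaves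
finitely many values for each index. -/
lemma tendsto_prod_cofinite_zero {ι : Type*} [Fintype ι] [Nonempty ι] {u : ι → ℕ → ℝ}
    (h0 : ∀ i k, 0 ≤ u i k) (h1 : ∀ i k, u i k ≤ 1) (hu : ∀ i, Tendsto (u i) atTop (𝓝 0)) :
    Tendsto (fun ν : ι → ℕ => ∏ i, u i (ν i)) cofinite (𝓝 0) := by
  classical
  rw [Metric.tendsto_nhds]
  intro ε hε
  have hfin : ∀ i, {k | ε ≤ u i k}.Finite := by
    intro i
    have := (Nat.cofinite_eq_atTop ▸ hu i).eventually (gt_mem_nhds hε)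
    simpa [eventually_cofinite] using this
  refine (Set.Finite.pi hfin).subset fun ν hν i _ => ?_
  have hν' : ε ≤ ∏ i, u i (ν i) := by
    have h2 : ¬ dist (∏ i, u i (ν i)) 0 < ε := hν
    rwa [Real.dist_0_eq_abs, abs_of_nonneg (Finset.prod_nonneg fun i _ => h0 i (ν i)),
      not_lt] at h2
  refine hν'.trans ?_
  rw [← Finset.mul_prod_erase _ _ (Finset.mem_univ i)]
  exact mul_le_of_le_one_right (h0 i _) (Finset.prod_le_one (fun k _ => h0 k _) fun k _ => h1 k _)

section

variable {p : ℕ} [Fact p.Prime]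

lemma PadicInt.norm_sub_le_of_toZModPow_eq {s : ℕ} {x y : ℤ_[p]}
    (h : PadicInt.toZModPow s x = PadicInt.toZModPow s y) : ‖x - y‖ ≤ (p : ℝ) ^ (-s : ℤ) := by
  rw [PadicInt.norm_le_pow_iff_mem_span_pow, ← PadicInt.ker_toZModPow, RingHom.mem_ker, map_sub, h,
    sub_self]

lemma PadicInt.toZModPow_eq_of_norm_sub_le {s : ℕ} {x y : ℤ_[p]}
    (h : ‖x - y‖ ≤ (p : ℝ) ^ (-s : ℤ)) : PadicInt.toZModPow s x = PadicInt.toZModPow s y := by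
  rwa [PadicInt.norm_le_pow_iff_mem_span_pow, ← PadicInt.ker_toZModPow, RingHom.mem_ker, map_sub,
    sub_eq_zero] at h

/-- The indicator function of a residue class modulo `p ^ s`, as a continuous function. -/
noncomputable def residueIndicator (s : ℕ) (c : ZMod (p ^ s)) : C(ℤ_[p], ℚ_[p]) where
  toFun x := if PadicInt.toZModPow s x = c then 1 else 0
  continuous_toFun := by
    refine IsLocallyConstant.continuous ((IsLocallyConstant.iff_eventually_eq _).2 fun x => ?_)
    have hp : (0 : ℝ) < (p : ℝ) ^ (-s : ℤ) :=
      zpow_pos (by exact_mod_cast (Fact.out : p.Prime).pos) _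
    filter_upwards [Metric.ball_mem_nhds x hp] with y hy
    rw [PadicInt.toZModPow_eq_of_norm_sub_le (x := y) (y := x) (s := s)
      (by simpa [dist_eq_norm] using (Metric.mem_ball.1 hy).le)]

lemma norm_residueIndicator_le (s : ℕ) (c : ZMod (p ^ s)) (x : ℤ_[p]) :
    ‖residueIndicator s c x‖ ≤ 1 := by
  simp only [residueIndicator, ContinuousMap.coe_mk]
  split_ifs <;> simp

variable {E : Type*} [AddCommGroup E] [Module ℚ_[p] E] [UniformSpace E] [IsUniformAddGroup E]
  {ι : Type*} [Fintype ι] [DecidableEq ι]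

omit [DecidableEq ι] in
lemma exists_toZModPow_seminorm_sub_lt {f : (ι → ℤ_[p]) → E} (hf : Continuous f)
    {q : Seminorm ℚ_[p] E} (hqc : Continuous q) {ε : ℝ} (hε : 0 < ε) :
    ∃ s : ℕ, ∀ x y : ι → ℤ_[p],
      (∀ i, PadicInt.toZModPow s (x i) = PadicInt.toZModPow s (y i)) → q (f y - f x) < ε := by
  have huc := CompactSpace.uniformContinuous_of_continuous hf
  have hV : {z : E × E | q (z.2 - z.1) < ε} ∈ uniformity E := by
    rw [uniformity_eq_comap_nhds_zero]
    have h0 : {e : E | q e < ε} ∈ 𝓝 (0 : E) :=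
      (isOpen_lt hqc continuous_const).mem_nhds (by simpa using hε)
    exact ⟨_, h0, fun z hz => hz⟩
  obtain ⟨δ, hδ, h⟩ := Metric.mem_uniformity_dist.1 (huc hV)
  obtain ⟨s, hs⟩ := PadicInt.exists_pow_neg_lt p hδ
  refine ⟨s, fun x y hxy => h ?_⟩
  rw [dist_pi_lt_iff hδ]
  intro i
  rw [dist_eq_norm]
  exact (PadicInt.norm_sub_le_of_toZModPow_eq (hxy i)).trans_lt hs

lemma tendsto_newtonCoeff_prod_residueIndicator [Nonempty ι] (s : ℕ) (c : ι → ZMod (p ^ s)) :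
    Tendsto (fun ν : ι → ℕ =>
      ‖newtonCoeff (fun μ : ι → ℕ => ∏ i, residueIndicator (p := p) s (c i) (μ i : ℤ_[p])) ν‖)
      cofinite (𝓝 0) := by
  -- Iterated differences at `0` only see natural numbers, so those on `ℕ` and on `ℤ_p` agree.
  have key : ∀ (i : ι) (m : ℕ),
      (fwdDiff 1)^[m] (fun k : ℕ => residueIndicator (p := p) s (c i) (k : ℤ_[p])) 0 =
      (fwdDiff 1)^[m] (residueIndicator (p := p) s (c i)) 0 := by
    intro i m
    simp only [fwdDiff_iter_eq_sum_shift]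
    simp
  simp_rw [newtonCoeff_prod (fun i k => residueIndicator (p := p) s (c i) (k : ℤ_[p])), key,
    norm_prod]
  refine tendsto_prod_cofinite_zero
    (u := fun i m => ‖(fwdDiff 1)^[m] (residueIndicator (p := p) s (c i)) 0‖)
    (fun i m => norm_nonneg _) (fun i m => ?_) fun i => ?_
  · refine (IsUltrametricDist.norm_fwdDiff_iter_apply_le 1 (residueIndicator s (c i)) 0 m).trans ?_
    exact (ContinuousMap.norm_le _ zero_le_one).2 (norm_residueIndicator_le s (c i))
  · have : IsBoundedSMul ℤ_[p] ℚ_[p] := .of_norm_smul_le fun r x => by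
      rw [Algebra.smul_def, norm_mul]
      rfl
    exact tendsto_zero_iff_norm_tendsto_zero.1
      (PadicInt.fwdDiff_tendsto_zero (residueIndicator s (c i)))

/-- The Newton coefficients of a continuous function on `ℤ_p^ι` tend to zero. -/
theorem tendsto_seminorm_newtonCoeff [Nonempty ι] {f : (ι → ℤ_[p]) → E} (hf : Continuous f)
    {q : Seminorm ℚ_[p] E} (hqc : Continuous q) (hq : IsNonarchimedean q) :
    Tendsto (fun ν : ι → ℕ => q (newtonCoeff (fun μ => f fun i => (μ i : ℤ_[p])) ν))
      cofinite (𝓝 0) := by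
  rw [Metric.tendsto_nhds]
  intro ε hε
  obtain ⟨s, hs⟩ := exists_toZModPow_seminorm_sub_lt hf hqc (half_pos hε)
  have hp0 : NeZero (p ^ s) := ⟨pow_ne_zero _ (Fact.out : p.Prime).ne_zero⟩
  set rep : (ι → ZMod (p ^ s)) → ι → ℤ_[p] := fun c i => ((c i).val : ℤ_[p]) with hrep
  have hrep' : ∀ c i, PadicInt.toZModPow s (rep c i) = c i := by
    intro c i
    simp [hrep]
  -- `g` replaces each point by the chosen representative of its class modulo `p ^ s`, so it takes
  -- finitely many values.
  set g : (ι → ℤ_[p]) → E := fun x => f (rep fun i => PadicInt.toZModPow s (x i)) with hg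
  have hgsum : ∀ x, g x = ∑ c : ι → ZMod (p ^ s),
      (∏ i, residueIndicator (p := p) s (c i) (x i)) • f (rep c) := by
    intro x
    rw [Finset.sum_eq_single fun i => PadicInt.toZModPow s (x i)]
    · simp [residueIndicator, hg]
    · intro c _ hc
      obtain ⟨i, hi⟩ := Function.ne_iff.1 hc
      rw [Finset.prod_eq_zero (Finset.mem_univ i), zero_smul]
      simp [residueIndicator, Ne.symm hi]
    · simp
  have hgt : Tendsto (fun ν : ι → ℕ => ∑ c : ι → ZMod (p ^ s),
      ‖newtonCoeff (fun μ : ι → ℕ => ∏ i, residueIndicator (p := p) s (c i) (μ i : ℤ_[p])) ν‖ *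
        q (f (rep c))) cofinite (𝓝 0) := by
    rw [show (0 : ℝ) = ∑ c : ι → ZMod (p ^ s), 0 * q (f (rep c)) by simp]
    exact tendsto_finsetSum _ fun c _ =>
      (tendsto_newtonCoeff_prod_residueIndicator s c).mul_const _
  filter_upwards [(Metric.tendsto_nhds.1 hgt) ε hε] with ν hν
  have hsplit : newtonCoeff (fun μ : ι → ℕ => f fun i => (μ i : ℤ_[p])) ν =
      newtonCoeff (fun μ : ι → ℕ => g fun i => (μ i : ℤ_[p])) ν +
      newtonCoeff (fun μ : ι → ℕ => (f fun i => (μ i : ℤ_[p])) - g fun i => (μ i : ℤ_[p])) ν := by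
    rw [← newtonCoeff_add]
    simp
  have h1 : q (newtonCoeff (fun μ : ι → ℕ => (f fun i => (μ i : ℤ_[p])) -
      g fun i => (μ i : ℤ_[p])) ν) ≤ ε / 2 :=
    seminorm_newtonCoeff_le hq (fun μ => (hs _ _ fun i =>
      hrep' (fun i => PadicInt.toZModPow s (μ i : ℤ_[p])) i).le) ν
  have h2 : q (newtonCoeff (fun μ : ι → ℕ => g fun i => (μ i : ℤ_[p])) ν) < ε := by
    simp only [hgsum, newtonCoeff_sum, newtonCoeff_smul]
    refine lt_of_le_of_lt ((Finset.le_sum_of_subadditive q (map_zero q).le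
      (map_add_le_add q) _ _).trans (le_of_eq ?_))
      ((le_abs_self _).trans_lt (by simpa using hν))
    simp [map_smul_eq_mul]
  rw [Real.dist_0_eq_abs, abs_of_nonneg (apply_nonneg _ _), hsplit]
  exact (hq _ _).trans_lt (max_lt h2 (h1.trans_lt (half_lt_self hε)))

end

/-! ### Ultrametric seminorms from open `ℤ_p`-submodules. -/

section

variable {p : ℕ} [Fact p.Prime] {E : Type*} [AddCommGroup E] [Module ℚ_[p] E]

/-- The absolute values of all nonzero scalars `c` with `x ∈ c N`. -/
def padicGaugeSet (N : Submodule (PadicInt.subring p) E) (x : E) : Set ℝ :=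
  {r | ∃ c : ℚ_[p], c ≠ 0 ∧ c⁻¹ • x ∈ N ∧ ‖c‖ = r}

lemma bddBelow_padicGaugeSet (N : Submodule (PadicInt.subring p) E) (x : E) :
    BddBelow (padicGaugeSet N x) :=
  ⟨0, by rintro _ ⟨c, -, -, rfl⟩; exact norm_nonneg c⟩

lemma smul_mem_of_norm_le_one {N : Submodule (PadicInt.subring p) E} {x : E} (hx : x ∈ N)
    {c : ℚ_[p]} (hc : ‖c‖ ≤ 1) : c • x ∈ N :=
  N.smul_mem (⟨c, hc⟩ : PadicInt.subring p) hx

lemma inv_smul_mem_of_norm_le {N : Submodule (PadicInt.subring p) E} {x : E} {c d : ℚ_[p]}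
    (hc0 : c ≠ 0) (hc : c⁻¹ • x ∈ N) (h : ‖c‖ ≤ ‖d‖) : d⁻¹ • x ∈ N := by
  have hd0 : 0 < ‖d‖ := (norm_pos_iff.2 hc0).trans_le h
  have h1 : d⁻¹ • x = (d⁻¹ * c) • c⁻¹ • x := by
    rw [smul_smul, mul_assoc, mul_inv_cancel₀ hc0, mul_one]
  rw [h1]
  refine smul_mem_of_norm_le_one hc ?_
  rw [norm_mul, norm_inv, inv_mul_le_iff₀ hd0, mul_one]
  exact h

/-- The gauge of a `ℤ_p`-submodule. -/
noncomputable def padicGauge (N : Submodule (PadicInt.subring p) E) (x : E) : ℝ :=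
  sInf (padicGaugeSet N x)

lemma padicGauge_nonneg (N : Submodule (PadicInt.subring p) E) (x : E) : 0 ≤ padicGauge N x :=
  Real.sInf_nonneg (by rintro _ ⟨c, -, -, rfl⟩; exact norm_nonneg c)

lemma padicGauge_le {N : Submodule (PadicInt.subring p) E} {x : E} {c : ℚ_[p]} (hc0 : c ≠ 0)
    (hc : c⁻¹ • x ∈ N) : padicGauge N x ≤ ‖c‖ :=
  csInf_le (bddBelow_padicGaugeSet N x) ⟨c, hc0, hc, rfl⟩

lemma padicGauge_le_one {N : Submodule (PadicInt.subring p) E} {x : E} (hx : x ∈ N) :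
    padicGauge N x ≤ 1 := by
  simpa using padicGauge_le (p := p) (c := 1) one_ne_zero (by simpa using hx)

variable {N : Submodule (PadicInt.subring p) E}

lemma mem_of_padicGauge_lt_one (hN : ∀ x, (padicGaugeSet N x).Nonempty) {x : E}
    (hx : padicGauge N x < 1) : x ∈ N := by
  obtain ⟨_, ⟨c, hc0, hc, rfl⟩, h⟩ := exists_lt_of_csInf_lt (hN x) hx
  simpa using inv_smul_mem_of_norm_le (d := 1) hc0 hc (by simpa using h.le)

/-- The sets `c N` are totally ordered by `‖c‖`, so both vectors lie in the larger of the two and so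
does their sum. -/
lemma padicGauge_add_le (hN : ∀ x, (padicGaugeSet N x).Nonempty) (x y : E) :
    padicGauge N (x + y) ≤ max (padicGauge N x) (padicGauge N y) := by
  refine le_of_forall_gt fun r hr => ?_
  obtain ⟨hx, hy⟩ := max_lt_iff.1 hr
  obtain ⟨_, ⟨c, hc0, hc, rfl⟩, h1⟩ := exists_lt_of_csInf_lt (hN x) hx
  obtain ⟨_, ⟨d, hd0, hd, rfl⟩, h2⟩ := exists_lt_of_csInf_lt (hN y) hy
  rcases le_total ‖c‖ ‖d‖ with h | h
  · refine (padicGauge_le hd0 ?_).trans_lt h2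
    rw [smul_add]
    exact N.add_mem (inv_smul_mem_of_norm_le hc0 hc h) hd
  · refine (padicGauge_le hc0 ?_).trans_lt h1
    rw [smul_add]
    exact N.add_mem hc (inv_smul_mem_of_norm_le hd0 hd h)

lemma padicGauge_zero (N : Submodule (PadicInt.subring p) E) : padicGauge N 0 = 0 := by
  refine le_antisymm (le_of_forall_pos_le_add fun ε hε => ?_) (padicGauge_nonneg N 0)
  obtain ⟨c, hc0, hc⟩ := NormedField.exists_norm_lt ℚ_[p] hε
  rw [zero_add]
  exact (padicGauge_le (norm_pos_iff.1 hc0) (by simp)).trans hc.le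

/-- The gauge of an absorbing `ℤ_p`-submodule, as a seminorm. -/
noncomputable def padicGaugeSeminorm (hN : ∀ x, (padicGaugeSet N x).Nonempty) :
    Seminorm ℚ_[p] E :=
  Seminorm.ofSMulLE (padicGauge N) (padicGauge_zero N)
    (fun x y => (padicGauge_add_le hN x y).trans
      (max_le_add_of_nonneg (padicGauge_nonneg N x) (padicGauge_nonneg N y)))
    (fun r x => by
      rcases eq_or_ne r 0 with rfl | hr
      · simp [padicGauge_zero N]
      rw [← div_le_iff₀' (norm_pos_iff.2 hr)]
      refine le_csInf (hN x) ?_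
      rintro _ ⟨c, hc0, hc, rfl⟩
      rw [div_le_iff₀' (norm_pos_iff.2 hr), ← norm_mul]
      refine padicGauge_le (mul_ne_zero hr hc0) ?_
      rwa [smul_smul, mul_inv, mul_assoc, mul_comm, mul_assoc, mul_inv_cancel₀ hr, mul_one])

lemma padicGaugeSet_nonempty [TopologicalSpace E] [ContinuousSMul ℚ_[p] E]
    (hN : IsOpen (N : Set E)) (x : E) : (padicGaugeSet N x).Nonempty := by
  have h : Tendsto (fun c : ℚ_[p] => c • x) (𝓝 0) (𝓝 0) := by
    have : Continuous fun c : ℚ_[p] => c • x := by fun_prop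
    simpa using this.tendsto 0
  have h2 : ∀ᶠ c : ℚ_[p] in 𝓝[≠] 0, c • x ∈ N :=
    (h.eventually (hN.mem_nhds N.zero_mem)).filter_mono nhdsWithin_le_nhds
  obtain ⟨c, hc, hc0⟩ := (h2.and self_mem_nhdsWithin).exists
  exact ⟨_, c⁻¹, inv_ne_zero hc0, by simpa using hc, rfl⟩

/-- Every open `ℤ_p`-submodule contains an open unit ball of a continuous ultrametric seminorm. -/
theorem exists_seminorm_lt_one_mem [TopologicalSpace E] [IsTopologicalAddGroup E]
    [ContinuousSMul ℚ_[p] E] (hN : IsOpen (N : Set E)) :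
    ∃ q : Seminorm ℚ_[p] E, Continuous q ∧ IsNonarchimedean q ∧ ∀ x, q x < 1 → x ∈ N := by
  have h := padicGaugeSet_nonempty hN
  refine ⟨padicGaugeSeminorm h, ?_, padicGauge_add_le h, fun x hx => mem_of_padicGauge_lt_one h hx⟩
  refine Seminorm.continuous' (r := 1) (mem_of_superset (hN.mem_nhds N.zero_mem) fun x hx => ?_)
  rw [Seminorm.mem_closedBall_zero]
  exact padicGauge_le_one hx

end

/-! ### Convergence of series in sequentially complete spaces. -/

section

variable {p : ℕ} [Fact p.Prime] {E : Type*} [AddCommGroup E] [Module ℚ_[p] E] [UniformSpace E]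
  [IsUniformAddGroup E] [ContinuousSMul ℚ_[p] E]

omit [ContinuousSMul ℚ_[p] E] in
lemma IsLocallyConvexPadic.nonarchimedeanAddGroup (hE : IsLocallyConvexPadic p E) :
    NonarchimedeanAddGroup E where
  is_nonarchimedean U hU := by
    obtain ⟨N, hN, h⟩ := hE U hU
    exact ⟨⟨N.toAddSubgroup, hN⟩, h⟩

omit [ContinuousSMul ℚ_[p] E] in
-- Countability of `I` gives a cofinal sequence of finite sets. Along it the Cauchy net of partial
-- sums converges, hence the whole net does.
lemma summable_of_tendsto_cofinite_zero_of_seqComplete {I : Type*} [Countable I]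
    (hE : IsLocallyConvexPadic p E)
    (hseq : ∀ u : ℕ → E, CauchySeq u → ∃ x : E, Tendsto u atTop (𝓝 x))
    {u : I → E} (hu : Tendsto u cofinite (𝓝 0)) : Summable u := by
  have := hE.nonarchimedeanAddGroup
  have hc := NonarchimedeanAddGroup.cauchySeq_sum_of_tendsto_cofinite_zero hu
  obtain ⟨s, hs⟩ := exists_seq_tendsto (atTop : Filter (Finset I))
  obtain ⟨x, hx⟩ := hseq _ (hc.comp_tendsto hs)
  exact ⟨x, tendsto_nhds_of_cauchySeq_of_subseq hc hs hx⟩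

/-- A series of continuous functions `T ν • a ν` converges to a continuous function if
`q (a ν) * sup ‖T ν‖` tends to zero for all continuous ultrametric seminorms `q`. -/
theorem exists_continuous_hasSum_smul {I X : Type*} [Countable I] [TopologicalSpace X]
    (hE : IsLocallyConvexPadic p E)
    (hseq : ∀ u : ℕ → E, CauchySeq u → ∃ x : E, Tendsto u atTop (𝓝 x))
    {T : I → X → ℚ_[p]} (hT : ∀ ν, Continuous (T ν)) {B : I → ℝ} (hB : ∀ ν x, ‖T ν x‖ ≤ B ν)
    {a : I → E} (ha : ∀ q : Seminorm ℚ_[p] E, Continuous q → IsNonarchimedean q →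
      Tendsto (fun ν => q (a ν) * B ν) cofinite (𝓝 0)) :
    ∃ g : X → E, Continuous g ∧ ∀ x, HasSum (fun ν => T ν x • a ν) (g x) := by
  have hev : ∀ N : Submodule (PadicInt.subring p) E, IsOpen (N : Set E) →
      ∀ᶠ ν in cofinite, ∀ x, T ν x • a ν ∈ N := by
    intro N hN
    obtain ⟨q, hqc, hq, hqN⟩ := exists_seminorm_lt_one_mem hN
    filter_upwards [(ha q hqc hq).eventually (gt_mem_nhds one_pos)] with ν hν x
    refine hqN _ (lt_of_le_of_lt ?_ hν)
    rw [map_smul_eq_mul, mul_comm]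
    exact mul_le_mul_of_nonneg_left (hB ν x) (apply_nonneg q _)
  have hsum : ∀ x, Summable fun ν => T ν x • a ν := by
    intro x
    refine summable_of_tendsto_cofinite_zero_of_seqComplete hE hseq fun W hW => ?_
    obtain ⟨N, hN, hNW⟩ := hE W hW
    exact (hev N hN).mono fun ν hν => hNW (hν x)
  choose g hg using hsum
  refine ⟨g, ?_, hg⟩
  have hunif : TendstoUniformly (fun (s : Finset I) x => ∑ ν ∈ s, T ν x • a ν) g atTop := by
    intro V hV
    rw [uniformity_eq_comap_nhds_zero] at hV
    obtain ⟨W, hW, hWV⟩ := hV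
    obtain ⟨N, hN, hNW⟩ := hE W hW
    have hfin : {ν | ¬ ∀ x, T ν x • a ν ∈ N}.Finite := hev N hN
    filter_upwards [eventually_ge_atTop hfin.toFinset] with s hs x
    refine hWV (hNW ?_)
    -- An open subgroup is closed, so a limit of finite tail sums in `N` stays in `N`; this bounds
    -- the remainder uniformly in `x`.
    have hcl : IsClosed (N : Set E) :=
      OpenAddSubgroup.isClosed (⟨N.toAddSubgroup, hN⟩ : OpenAddSubgroup E)
    have ht : Tendsto (fun t : Finset I => ∑ ν ∈ s, T ν x • a ν - ∑ ν ∈ t, T ν x • a ν) atTop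
        (𝓝 (∑ ν ∈ s, T ν x • a ν - g x)) := tendsto_const_nhds.sub (hg x)
    refine hcl.mem_of_tendsto ht ?_
    filter_upwards [eventually_ge_atTop s] with t hst
    classical
    rw [← Finset.sum_sdiff hst, sub_add_cancel_right]
    refine N.neg_mem (N.sum_mem fun ν hν => ?_)
    by_contra hcon
    exact (Finset.mem_sdiff.1 hν).2 (hs (hfin.mem_toFinset.2 fun h => hcon (h x)))
  refine hunif.continuous (Frequently.of_forall fun s => ?_)
  exact continuous_finsetSum _ fun ν _ => (hT ν).smul continuous_const

end

/-! ### The Mahler expansion. -/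

section

variable {p : ℕ} [Fact p.Prime]

lemma continuous_coe_choose (k : ℕ) :
    Continuous fun x : ℤ_[p] => ((Ring.choose x k : ℤ_[p]) : ℚ_[p]) :=
  continuous_subtype_val.comp (PadicInt.continuous_choose k)

lemma coe_multiChoose {n : ℕ} (x : Fin n → ℤ_[p]) (ν : Fin n → ℕ) :
    (multiChoose x ν : ℚ_[p]) = ∏ i, ((Ring.choose (x i) (ν i) : ℤ_[p]) : ℚ_[p]) :=
  map_prod (PadicInt.Coe.ringHom (p := p)) _ _

lemma continuous_coe_multiChoose {n : ℕ} (ν : Fin n → ℕ) :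
    Continuous fun x : Fin n → ℤ_[p] => (multiChoose x ν : ℚ_[p]) := by
  simp only [coe_multiChoose]
  exact continuous_finsetProd _ fun i _ => (continuous_coe_choose (ν i)).comp (continuous_apply i)

lemma multiChoose_natCast {n : ℕ} (μ ν : Fin n → ℕ) :
    (multiChoose (fun i => (μ i : ℤ_[p])) ν : ℚ_[p]) =
      ((∏ i, ((μ i).choose (ν i) : ℤ) : ℤ) : ℚ_[p]) := by
  simp [coe_multiChoose, Ring.choose_natCast]

variable {n : ℕ} {E : Type*} [AddCommGroup E] [Module ℚ_[p] E] [UniformSpace E]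
  [IsUniformAddGroup E] [ContinuousSMul ℚ_[p] E] [T2Space E]

/-- **Mahler's theorem** in several variables. -/
theorem hasSum_multiChoose_smul_mahlerCoeff [Nonempty (Fin n)] (hE : IsLocallyConvexPadic p E)
    (hseq : ∀ u : ℕ → E, CauchySeq u → ∃ x : E, Tendsto u atTop (𝓝 x))
    {f : (Fin n → ℤ_[p]) → E} (hf : Continuous f) (x : Fin n → ℤ_[p]) :
    HasSum (fun ν : Fin n → ℕ => (multiChoose x ν : ℚ_[p]) • mahlerCoeff f ν) (f x) := by
  obtain ⟨g, hg, hsum⟩ := exists_continuous_hasSum_smul hE hseq (B := fun _ => 1)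
    (T := fun ν (x : Fin n → ℤ_[p]) => (multiChoose x ν : ℚ_[p])) continuous_coe_multiChoose
    (fun ν x => PadicInt.norm_le_one _) (a := mahlerCoeff f) (fun q hqc hq => by
      simpa only [mul_one, mahlerCoeff_eq_newtonCoeff] using tendsto_seminorm_newtonCoeff hf hqc hq)
  have hdense : DenseRange fun (μ : Fin n → ℕ) (i : Fin n) => (μ i : ℤ_[p]) :=
    DenseRange.piMap fun _ => PadicInt.denseRange_natCast
  have hfg : g = f := by
    -- At a point of `ℕ^n` the series is finite and is Newton's formula.
    refine hdense.equalizer hg hf (funext fun μ => ?_)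
    have h1 : f (fun i => (μ i : ℤ_[p])) = ∑ ν ∈ indexBox μ,
        (multiChoose (fun i => (μ i : ℤ_[p])) ν : ℚ_[p]) • mahlerCoeff f ν := by
      simp only [multiChoose_natCast, Int.cast_smul_eq_zsmul, mahlerCoeff_eq_newtonCoeff]
      exact (sum_choose_smul_newtonCoeff (fun μ : Fin n → ℕ => f fun i => (μ i : ℤ_[p])) μ).symm
    simp only [Function.comp_apply]
    rw [h1]
    refine (hsum _).unique (hasSum_sum_of_ne_finset_zero fun ν hν => ?_)
    have h2 : ¬ ν ≤ μ := fun h => hν (mem_indexBox.2 h)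
    obtain ⟨i, hi⟩ := not_forall.1 h2
    rw [multiChoose_natCast, Finset.prod_eq_zero (Finset.mem_univ i), Int.cast_zero, zero_smul]
    exact_mod_cast Nat.choose_eq_zero_of_lt (not_le.1 hi)
  exact hfg ▸ hsum x

end

/-! ### Divided differences of binomial functions. -/

section

variable {p : ℕ} [Fact p.Prime]

/-- The divided difference of a function `φ : ℤ_p → ℚ_p` at the points `x 0, …, x j`. -/
noncomputable def dividedDiff {p : ℕ} [Fact p.Prime] (φ : ℤ_[p] → ℚ_[p]) {j : ℕ}
    (x : Fin (j + 1) → ℤ_[p]) : ℚ_[p] :=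
  ∑ a, (∏ k ∈ Finset.univ.erase a, ((x a : ℚ_[p]) - (x k : ℚ_[p]))⁻¹) * φ (x a)

lemma prod_erase_succ_eq {M : Type*} [CommMonoid M] {j : ℕ} (b : Fin (j + 1)) (u : Fin (j + 2) → M) :
    ∏ k ∈ Finset.univ.erase b.succ, u k = u 0 * ∏ k ∈ Finset.univ.erase b, u k.succ := by
  rw [Fin.univ_succ, Finset.cons_eq_insert, Finset.erase_insert_of_ne (Fin.succ_ne_zero b).symm,
    Finset.prod_insert (by simp)]
  congr 1
  have : (Finset.univ.map (Fin.succEmb (j + 1))).erase (Fin.succ b) =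
      (Finset.univ.erase b).map (Fin.succEmb (j + 1)) := by
    rw [Finset.map_erase]
    rfl
  refine (Finset.prod_congr this fun _ _ => rfl).trans ?_
  rw [Finset.prod_map]
  rfl

/-- The divided difference is the top coefficient, of degree `j + 1 > 0`, of the interpolation
polynomial, here the constant `1`. -/
lemma dividedDiff_one {j : ℕ} {x : Fin (j + 2) → ℤ_[p]} (hx : Function.Injective x) :
    dividedDiff (fun _ => 1) x = 0 := by
  have h := Lagrange.coeff_eq_sum (s := Finset.univ) (v := fun a => (x a : ℚ_[p]))
    (fun a _ b _ hab => hx (Subtype.coe_injective hab)) (P := 1) (by simp; exact_mod_cast Nat.succ_pos _)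
  rw [Polynomial.coeff_one, if_neg (by simp)] at h
  simp only [dividedDiff, h, Finset.prod_inv_distrib, Polynomial.eval_one, mul_one, one_div]

/-- Newton's recursion: a divided difference at `x 0, …, x (j + 1)` is the divided difference at
`x 1, …, x (j + 1)` of the difference quotient with base point `x 0`. -/
lemma dividedDiff_succ {j : ℕ} {x : Fin (j + 2) → ℤ_[p]} (hx : Function.Injective x)
    {φ ψ : ℤ_[p] → ℚ_[p]}
    (h : ∀ y, φ y = φ (x 0) + ((y : ℚ_[p]) - (x 0 : ℚ_[p])) * ψ y) :
    dividedDiff φ x = dividedDiff ψ (Fin.tail x) := by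
  have h1 : dividedDiff φ x = φ (x 0) * dividedDiff (fun _ => 1) x +
      dividedDiff (fun y => ((y : ℚ_[p]) - (x 0 : ℚ_[p])) * ψ y) x := by
    simp only [dividedDiff, Finset.mul_sum, ← Finset.sum_add_distrib]
    refine Finset.sum_congr rfl fun a _ => ?_
    rw [h (x a)]
    ring
  rw [h1, dividedDiff_one hx, mul_zero, zero_add, dividedDiff, Fin.sum_univ_succ, sub_self, zero_mul,
    mul_zero, zero_add]
  refine Finset.sum_congr rfl fun b _ => ?_
  have hne : (x b.succ : ℚ_[p]) - (x 0 : ℚ_[p]) ≠ 0 := by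
    rw [sub_ne_zero]
    exact fun h => Fin.succ_ne_zero b (hx (Subtype.coe_injective h))
  rw [prod_erase_succ_eq b fun k => ((x b.succ : ℚ_[p]) - (x k : ℚ_[p]))⁻¹]
  simp only [Fin.tail]
  field_simp

/-- The continuous extension of the `j`-th divided difference of `(· choose k)`. -/
noncomputable def chooseDividedDiff (p : ℕ) [Fact p.Prime] :
    (j : ℕ) → ℕ → (Fin (j + 1) → ℤ_[p]) → ℚ_[p]
  | 0, k, x => (Ring.choose (x 0) k : ℤ_[p])
  | j + 1, k, x => ∑ i ∈ Finset.range k, ((Ring.choose (x 0) (k - 1 - i) : ℤ_[p]) : ℚ_[p]) *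
      (((i + 1 : ℕ) : ℚ_[p])⁻¹ * chooseDividedDiff p j i fun a => Fin.tail x a - x 0 - 1)

lemma continuous_chooseDividedDiff (j k : ℕ) : Continuous (chooseDividedDiff p j k) := by
  induction j generalizing k with
  | zero =>
    exact (continuous_coe_choose k).comp (continuous_apply 0)
  | succ j ih =>
    refine continuous_finsetSum _ fun i _ => ?_
    have h : Continuous fun x : Fin (j + 2) → ℤ_[p] =>
        chooseDividedDiff p j i fun a => Fin.tail x a - x 0 - 1 := by
      refine (ih i).comp (continuous_pi fun a => ?_)
      simp only [Fin.tail]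
      fun_prop
    exact ((continuous_coe_choose _).comp (continuous_apply 0)).mul (continuous_const.mul h)

/-- The norm is the `p`-part of `i + 1`, a divisor of `i + 1`. -/
lemma norm_natCast_inv_le (i : ℕ) : ‖(((i + 1 : ℕ) : ℚ_[p]))⁻¹‖ ≤ (i + 1 : ℕ) := by
  have hp := (Fact.out : p.Prime)
  rw [norm_inv, Padic.norm_eq_zpow_neg_valuation (by exact_mod_cast Nat.succ_ne_zero i),
    ← zpow_neg, neg_neg, Padic.valuation_natCast, zpow_natCast]
  exact_mod_cast Nat.le_of_dvd (Nat.succ_pos i) pow_padicValNat_dvd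

/-- Each recursion level contributes one factor `1 / (i + 1)` with `i + 1 ≤ k`; binomial values are
integral. -/
lemma norm_chooseDividedDiff_le (j k : ℕ) (x : Fin (j + 1) → ℤ_[p]) :
    ‖chooseDividedDiff p j k x‖ ≤ ((max k 1 : ℕ) : ℝ) ^ j := by
  induction j generalizing k with
  | zero => simpa [chooseDividedDiff] using PadicInt.norm_le_one _
  | succ j ih =>
    refine IsUltrametricDist.norm_sum_le_of_forall_le_of_nonneg (by positivity) fun i hi => ?_
    rw [Finset.mem_range] at hi
    rw [norm_mul, norm_mul, pow_succ']
    refine (mul_le_of_le_one_left (by positivity) (PadicInt.norm_le_one _)).trans ?_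
    refine mul_le_mul ((norm_natCast_inv_le i).trans ?_) ((ih i _).trans ?_) (norm_nonneg _)
      (by positivity)
    · exact_mod_cast (show i + 1 ≤ max k 1 by lia)
    · gcongr

lemma mul_choose_eq_natCast_mul_choose (y : ℤ_[p]) (i : ℕ) :
    ((i + 1 : ℕ) : ℤ_[p]) * Ring.choose y (i + 1) = y * Ring.choose (y - 1) i := by
  have h1 : Continuous fun y : ℤ_[p] => ((i + 1 : ℕ) : ℤ_[p]) * Ring.choose y (i + 1) :=
    continuous_const.mul (PadicInt.continuous_choose _)
  have h2 : Continuous fun y : ℤ_[p] => y * Ring.choose (y - 1) i :=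
    continuous_id.mul ((PadicInt.continuous_choose _).comp (continuous_id.sub continuous_const))
  refine congrFun (PadicInt.denseRange_natCast.equalizer h1 h2 (funext fun m => ?_)) y
  cases m with
  | zero => simp [Ring.choose_zero_succ]
  | succ m =>
    simp only [Function.comp_apply, Nat.cast_succ m, add_sub_cancel_right]
    rw [← Nat.cast_succ m, Ring.choose_natCast, Ring.choose_natCast]
    exact_mod_cast ((mul_comm _ _).trans (Nat.add_one_mul_choose_eq m i).symm)

/-- Vandermonde for `y = (y - x₀) + x₀`: the term of index `0` is the value at `x₀`, and absorption
extracts a factor `y - x₀` from the others. The sum is thus the difference quotient that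
`dividedDiff_succ` needs. -/
lemma choose_eq_add_mul_sum (x₀ y : ℤ_[p]) (k : ℕ) :
    ((Ring.choose y k : ℤ_[p]) : ℚ_[p]) = ((Ring.choose x₀ k : ℤ_[p]) : ℚ_[p]) +
      ((y : ℚ_[p]) - (x₀ : ℚ_[p])) * ∑ i ∈ Finset.range k,
        ((Ring.choose x₀ (k - 1 - i) : ℤ_[p]) : ℚ_[p]) *
        (((i + 1 : ℕ) : ℚ_[p])⁻¹ * ((Ring.choose (y - x₀ - 1) i : ℤ_[p]) : ℚ_[p])) := by
  have h := Ring.add_choose_eq k (Commute.all (y - x₀) x₀)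
  rw [sub_add_cancel, Finset.Nat.sum_antidiagonal_eq_sum_range_succ
    (fun a b => Ring.choose (y - x₀) a * Ring.choose x₀ b), Finset.sum_range_succ', add_comm] at h
  simp only [Ring.choose_zero_right, one_mul, Nat.sub_zero] at h
  rw [h, PadicInt.coe_add, PadicInt.coe_sum, Finset.mul_sum]
  congr 1
  refine Finset.sum_congr rfl fun i _ => ?_
  have h1 := congrArg (fun z : ℤ_[p] => (z : ℚ_[p])) (mul_choose_eq_natCast_mul_choose (y - x₀) i)
  simp only [PadicInt.coe_mul, PadicInt.coe_natCast, PadicInt.coe_sub (y) x₀] at h1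
  have hne : ((i + 1 : ℕ) : ℚ_[p]) ≠ 0 := by exact_mod_cast Nat.succ_ne_zero i
  rw [show k - (i + 1) = k - 1 - i by lia, PadicInt.coe_mul]
  field_simp
  linear_combination ((Ring.choose x₀ (k - 1 - i) : ℤ_[p]) : ℚ_[p]) * h1

lemma dividedDiff_sum {κ : Type*} (s : Finset κ) (c : κ → ℚ_[p]) (φ : κ → ℤ_[p] → ℚ_[p]) {j : ℕ}
    (x : Fin (j + 1) → ℤ_[p]) :
    dividedDiff (fun y => ∑ i ∈ s, c i * φ i y) x = ∑ i ∈ s, c i * dividedDiff (φ i) x := by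
  simp only [dividedDiff, Finset.mul_sum]
  rw [Finset.sum_comm]
  exact Finset.sum_congr rfl fun i _ => Finset.sum_congr rfl fun a _ => by ring

/-- At distinct points, `chooseDividedDiff` is the divided difference of `(· choose k)`. -/
theorem dividedDiff_choose {j : ℕ} {x : Fin (j + 1) → ℤ_[p]} (hx : Function.Injective x) (k : ℕ) :
    dividedDiff (fun y => ((Ring.choose y k : ℤ_[p]) : ℚ_[p])) x = chooseDividedDiff p j k x := by
  induction j generalizing k with
  | zero => simp [dividedDiff, chooseDividedDiff]
  | succ j ih =>
    rw [dividedDiff_succ hx (fun y => choose_eq_add_mul_sum (x 0) y k), chooseDividedDiff]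
    simp only [← mul_assoc]
    rw [dividedDiff_sum]
    refine Finset.sum_congr rfl fun i _ => ?_
    -- Divided differences are translation invariant, so the shift by `x 0 + 1` moves from the
    -- function to the nodes.
    rw [← ih (x := fun a => Fin.tail x a - x 0 - 1)]
    · simp [dividedDiff]
    · intro a b hab
      simpa using hx (sub_left_injective (sub_left_injective hab))

end

/-! ### Step coordinates and lower bounds. -/

lemma comap_sum_atTop {ι : Type*} [Fintype ι] :
    comap (fun ν : ι → ℕ => ∑ i, ν i) atTop = cofinite := by
  classical
  refine le_antisymm ?_ ?_
  · intro s hs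
    obtain ⟨M, hM⟩ := ((mem_cofinite.1 hs).image fun ν : ι → ℕ => ∑ i, ν i).bddAbove
    refine ⟨Set.Ioi M, Ioi_mem_atTop M, fun ν hν => ?_⟩
    by_contra h
    exact (lt_irrefl _) ((Set.mem_Ioi.1 hν).trans_le (hM ⟨ν, h, rfl⟩))
  · refine tendsto_iff_comap.1 (tendsto_atTop.2 fun M => ?_)
    refine (Set.finite_Iic (fun _ : ι => M)).subset fun ν hν i => ?_
    have h : ∑ i, ν i < M := not_le.1 hν
    exact (Finset.single_le_sum (fun _ _ => Nat.zero_le _) (Finset.mem_univ i)).trans h.le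

lemma absAtTop_eq_cofinite (n : ℕ) : absAtTop n = cofinite := comap_sum_atTop

lemma fwdDiff_iter_natCast_choose_zero {R : Type*} [CommRing R] (m j : ℕ) :
    (fwdDiff 1)^[m] (fun k : ℕ => (k.choose j : R)) 0 = if m = j then 1 else 0 := by
  rw [fwdDiff_iter_zero_eq_sum_newtonKernel]
  have h := congrArg (Int.cast (R := R)) (sum_newtonKernel_mul_choose m j)
  push_cast at h
  simpa [zsmul_eq_mul] using h

/-- The points `y 0 + ⋯ + y a + a` for `a = 0, …, j`. -/
def stepPoints {R : Type*} [AddMonoidWithOne R] : (j : ℕ) → (Fin (j + 1) → R) → Fin (j + 1) → R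
  | 0, y => y
  | j + 1, y => Fin.cons (y 0) fun a => stepPoints j (Fin.tail y) a + y 0 + 1

/-- Natural step coordinates therefore give points where the extension is the actual difference
quotient. -/
lemma stepPoints_injective (j : ℕ) (y : Fin (j + 1) → ℕ) : Function.Injective (stepPoints j y) := by
  induction j with
  | zero => exact fun a b _ => Subsingleton.elim (α := Fin 1) a b
  | succ j ih =>
    rw [stepPoints, Fin.cons_injective_iff]
    refine ⟨?_, fun a b hab => ih (Fin.tail y) (by simpa using hab)⟩
    rintro ⟨a, ha⟩
    simp only at ha
    lia

lemma stepPoints_natCast {R : Type*} [AddMonoidWithOne R] (j : ℕ) (y : Fin (j + 1) → ℕ) :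
    stepPoints j (fun a => (y a : R)) = fun a => ((stepPoints j y a : ℕ) : R) := by
  induction j with
  | zero => rfl
  | succ j ih =>
    have h : Fin.tail (fun a => (y a : R)) = fun a => ((Fin.tail y a : ℕ) : R) := rfl
    funext a
    refine Fin.cases ?_ (fun a => ?_) a
    · simp [stepPoints]
    · simp [stepPoints, h, ih]

lemma continuous_stepPoints {R : Type*} [AddMonoidWithOne R] [TopologicalSpace R] [ContinuousAdd R]
    (j : ℕ) : Continuous (stepPoints (R := R) j) := by
  induction j with
  | zero => exact continuous_id
  | succ j ih =>
    refine continuous_pi fun a => ?_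
    refine Fin.cases ?_ (fun a => ?_) a
    · simpa [stepPoints] using continuous_apply 0
    · simp only [stepPoints, Fin.cons_succ]
      have h : Continuous fun y : Fin (j + 2) → R => stepPoints j (Fin.tail y) a :=
        (continuous_apply a).comp (ih.comp (continuous_pi fun b => continuous_apply b.succ))
      exact (h.add (continuous_apply 0)).add continuous_const

section

variable {p : ℕ} [Fact p.Prime]

/-- The step coordinates undo the shift by `x 0 + 1` in the recursion, so the variable `y 0`
separates from the others. -/
lemma chooseDividedDiff_succ_stepPoints (j k : ℕ) (y : Fin (j + 2) → ℤ_[p]) :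
    chooseDividedDiff p (j + 1) k (stepPoints (j + 1) y) =
      ∑ i ∈ Finset.range k, ((Ring.choose (y 0) (k - 1 - i) : ℤ_[p]) : ℚ_[p]) *
        (((i + 1 : ℕ) : ℚ_[p])⁻¹ * chooseDividedDiff p j i (stepPoints j (Fin.tail y))) := by
  rw [chooseDividedDiff]
  refine Finset.sum_congr rfl fun i _ => ?_
  have h : (fun a => Fin.tail (stepPoints (j + 1) y) a - stepPoints (j + 1) y 0 - 1) =
      stepPoints j (Fin.tail y) := by
    funext a
    simp only [stepPoints, Fin.tail, Fin.cons_succ, Fin.cons_zero]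
    ring
  rw [h]
  simp [stepPoints]

/-- The Newton coefficients of the `j`-th divided difference of `(· choose k)` in the step
coordinates. -/
noncomputable def stepCoeff (p : ℕ) [Fact p.Prime] (j k : ℕ) (l : Fin (j + 1) → ℕ) : ℚ_[p] :=
  newtonCoeff (fun y : Fin (j + 1) → ℕ =>
    chooseDividedDiff p j k (stepPoints j fun a => (y a : ℤ_[p]))) l

lemma stepCoeff_zero (k : ℕ) (l : Fin 1 → ℕ) :
    stepCoeff p 0 k l = if l 0 = k then 1 else 0 := by
  have h := newtonCoeff_prod (ι := Fin 1) (fun _ m => (m.choose k : ℚ_[p])) l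
  simp only [Fin.prod_univ_succ, Finset.univ_eq_empty, Finset.prod_empty, mul_one,
    fwdDiff_iter_natCast_choose_zero] at h
  simpa [stepCoeff, chooseDividedDiff, stepPoints, Ring.choose_natCast] using h

lemma stepCoeff_succ (j k : ℕ) (l : Fin (j + 2) → ℕ) :
    stepCoeff p (j + 1) k l = ∑ i ∈ Finset.range k, (if l 0 = k - 1 - i then 1 else 0) *
      (((i + 1 : ℕ) : ℚ_[p])⁻¹ * stepCoeff p j i (Fin.tail l)) := by
  simp only [stepCoeff, chooseDividedDiff_succ_stepPoints, newtonCoeff_sum]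
  refine Finset.sum_congr rfl fun i _ => ?_
  have h := newtonCoeff_cons (fun m => (m.choose (k - 1 - i) : ℚ_[p]))
    (fun y : Fin (j + 1) → ℕ => ((i + 1 : ℕ) : ℚ_[p])⁻¹ *
      chooseDividedDiff p j i (stepPoints j fun a => (y a : ℤ_[p]))) l
  simp only [fwdDiff_iter_natCast_choose_zero] at h
  have h2 : ∀ φ : (Fin (j + 1) → ℕ) → ℚ_[p], newtonCoeff (fun y => ((i + 1 : ℕ) : ℚ_[p])⁻¹ * φ y)
      (Fin.tail l) = ((i + 1 : ℕ) : ℚ_[p])⁻¹ * newtonCoeff φ (Fin.tail l) := by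
    intro φ
    simp only [newtonCoeff, Finset.mul_sum, mul_smul_comm]
  rw [h2] at h
  rw [← h]
  congr 1
  funext y
  rw [Ring.choose_natCast, PadicInt.coe_natCast]
  rfl

/-- In the recursion, `l 0` selects the single term `i = k - 1 - l 0`. Choosing `i + 1` as the
largest power of `p` up to `k` gives `1 / (i + 1)` norm `i + 1 > k / p`, and `i` is still comparable
to `k` for the next level. -/
lemma exists_stepCoeff_large (j : ℕ) : ∃ C : ℝ, 0 < C ∧ ∃ N : ℕ, ∀ k, N ≤ k →
    ∃ l : Fin (j + 1) → ℕ, ∑ a, l a + j = k ∧ ∃ γ : ℚ_[p], (k : ℝ) ^ j ≤ C * ‖γ‖ ∧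
      ∀ k', stepCoeff p j k' l = if k' = k then γ else 0 := by
  have hp := (Fact.out : p.Prime)
  induction j with
  | zero =>
    refine ⟨1, one_pos, 0, fun k _ => ⟨fun _ => k, by simp, 1, by simp, fun k' => ?_⟩⟩
    simp [stepCoeff_zero, eq_comm]
  | succ j ih =>
    obtain ⟨C, hC, N, h⟩ := ih
    -- The factor `p` comes from `k < p * (i + 1)`, and `(2 * p) ^ j` from `k ≤ 2 * p * i`. The
    -- threshold ensures that `i ≥ N` and `i ≥ 1`.
    refine ⟨p * (2 * p) ^ j * C, by have := hp.pos; positivity, p * (N + 2), fun k hk => ?_⟩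
    have hk0 : k ≠ 0 := by
      have := hp.pos
      have : 0 < p * (N + 2) := by positivity
      lia
    obtain ⟨i, hi⟩ : ∃ i, p ^ Nat.log p k = i + 1 :=
      Nat.exists_eq_succ_of_ne_zero (pow_ne_zero _ hp.ne_zero)
    have hik : i + 1 ≤ k := hi ▸ Nat.pow_log_le_self p hk0
    have hki : k < p * (i + 1) := by
      rw [← hi, mul_comm, ← pow_succ]
      exact Nat.lt_pow_succ_log_self hp.one_lt k
    have hNi : N + 2 < i + 1 := Nat.lt_of_mul_lt_mul_left (hk.trans_lt hki)
    obtain ⟨l, hl, γ, hγ, hcoeff⟩ := h i (by lia)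
    refine ⟨Fin.cons (k - 1 - i) l, ?_, ((i + 1 : ℕ) : ℚ_[p])⁻¹ * γ, ?_, fun k' => ?_⟩
    · rw [Fin.sum_univ_succ]
      simp only [Fin.cons_zero, Fin.cons_succ]
      lia
    · have hnorm : ‖((i + 1 : ℕ) : ℚ_[p])⁻¹‖ = (i + 1 : ℕ) := by
        rw [← hi]
        simp
      rw [norm_mul, hnorm, pow_succ']
      have h1 : (k : ℝ) ≤ p * (i + 1 : ℕ) := by exact_mod_cast hki.le
      have h2 : (k : ℝ) ≤ 2 * p * i := by
        have : p * (i + 1) ≤ p * (2 * i) := Nat.mul_le_mul_left p (by lia)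
        have : k ≤ 2 * p * i := by nlinarith
        exact_mod_cast this
      calc (k : ℝ) * k ^ j ≤ (p * (i + 1 : ℕ)) * (2 * p * i) ^ j := by gcongr
        _ = p * (2 * p) ^ j * ((i + 1 : ℕ) * i ^ j) := by rw [mul_pow]; ring
        _ ≤ p * (2 * p) ^ j * ((i + 1 : ℕ) * (C * ‖γ‖)) := by gcongr
        _ = p * (2 * p) ^ j * C * ((i + 1 : ℕ) * ‖γ‖) := by ring
    · rw [stepCoeff_succ]
      simp only [Fin.tail_cons, Fin.cons_zero, hcoeff, mul_ite, mul_zero]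
      rw [Finset.sum_ite_eq']
      simp only [Finset.mem_range]
      by_cases hkk : k' = k
      · subst hkk
        rw [if_pos (by lia), if_pos rfl, if_pos rfl, one_mul]
      · rw [if_neg hkk]
        split_ifs with h1 h2
        · lia
        · simp
        · rfl

/-- Some entries of `ν` may stay small while `|ν| → ∞`. For those the order drops to `j' = 0`, where
the scalar is `1` and the bounded weight is absorbed into `C`; this uses that `C^α` covers all `β ≤
α`. -/
lemma exists_stepCoeff_ge (j : ℕ) : ∃ C : ℝ, 0 < C ∧ ∀ k : ℕ, ∃ j' ≤ j,
    ∃ l : Fin (j' + 1) → ℕ, ∑ a, l a + j' = k ∧ ∃ γ : ℚ_[p],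
      ((max k 1 : ℕ) : ℝ) ^ j ≤ C * ‖γ‖ ∧ ∀ k', stepCoeff p j' k' l = if k' = k then γ else 0 := by
  obtain ⟨C, hC, N, h⟩ := exists_stepCoeff_large (p := p) j
  refine ⟨max C (((max N 1 : ℕ) : ℝ) ^ j), lt_max_of_lt_left hC, fun k => ?_⟩
  by_cases hk : max N 1 ≤ k
  · obtain ⟨l, hl, γ, hγ, hc⟩ := h k (le_of_max_le_left hk)
    refine ⟨j, le_rfl, l, hl, γ, ?_, hc⟩
    rw [max_eq_left (le_of_max_le_right hk)]
    exact hγ.trans (by gcongr; exact le_max_left _ _)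
  · refine ⟨0, Nat.zero_le _, fun _ => k, by simp, 1, ?_, fun k' => ?_⟩
    · rw [norm_one, mul_one]
      refine le_max_of_le_right ?_
      gcongr
      lia
    · simp [stepCoeff_zero, eq_comm]

end

/-! ### Difference quotients of Mahler series and the two directions of (ii). -/

section

variable {p : ℕ} [Fact p.Prime] {n : ℕ} {E : Type*} [AddCommGroup E] [Module ℚ_[p] E]

lemma diffQuotSet_injective {β : Fin n → ℕ} {x : DiffQuotDomain p β} (hx : x ∈ diffQuotSet p β)
    (i : Fin n) : Function.Injective (x i) := by
  intro a b hab
  by_contra hne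
  rcases lt_or_gt_of_ne hne with h | h
  · exact hx i a b h hab
  · exact hx i b a h hab.symm

lemma mem_diffQuotSet_of_injective {β : Fin n → ℕ} {x : DiffQuotDomain p β}
    (hx : ∀ i, Function.Injective (x i)) : x ∈ diffQuotSet p β :=
  fun i _ _ hjk h => hjk.ne (hx i h)

lemma sum_prod_inv_mul_multiChoose {β : Fin n → ℕ} {x : DiffQuotDomain p β}
    (hx : x ∈ diffQuotSet p β) (ν : Fin n → ℕ) :
    ∑ j : (∀ i : Fin n, Fin (β i + 1)),
      (∏ i, ∏ k ∈ Finset.univ.erase (j i), ((x i (j i) : ℚ_[p]) - (x i k : ℚ_[p]))⁻¹) *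
        (multiChoose (fun i => x i (j i)) ν : ℚ_[p]) =
      ∏ i, chooseDividedDiff p (β i) (ν i) (x i) := by
  simp only [← dividedDiff_choose (diffQuotSet_injective hx _), dividedDiff, Finset.prod_univ_sum,
    Fintype.piFinset_univ, Finset.prod_mul_distrib, coe_multiChoose]

variable [UniformSpace E] [IsUniformAddGroup E] [ContinuousSMul ℚ_[p] E]

lemma hasSum_diffQuot {f : (Fin n → ℤ_[p]) → E} {a : (Fin n → ℕ) → E}
    (hf : ∀ x, HasSum (fun ν => (multiChoose x ν : ℚ_[p]) • a ν) (f x))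
    {β : Fin n → ℕ} {x : DiffQuotDomain p β} (hx : x ∈ diffQuotSet p β) :
    HasSum (fun ν => (∏ i, chooseDividedDiff p (β i) (ν i) (x i)) • a ν) (diffQuot f β x) := by
  simp only [← sum_prod_inv_mul_multiChoose hx, Finset.sum_smul, mul_smul]
  exact hasSum_sum fun j _ => (hf _).const_smul _

variable [T2Space E]

lemma newtonCoeff_diffQuot_stepPoints {f : (Fin n → ℤ_[p]) → E} {a : (Fin n → ℕ) → E}
    (hf : ∀ x, HasSum (fun ν => (multiChoose x ν : ℚ_[p]) • a ν) (f x))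
    {β ν : Fin n → ℕ} {l : ∀ i, Fin (β i + 1) → ℕ} {γ : Fin n → ℚ_[p]}
    (h : ∀ i k, stepCoeff p (β i) k (l i) = if k = ν i then γ i else 0) :
    newtonCoeff (fun y : (Σ i, Fin (β i + 1)) → ℕ =>
        diffQuot f β fun i => stepPoints (β i) fun a => (y ⟨i, a⟩ : ℤ_[p])) (fun s => l s.1 s.2) =
      (∏ i, γ i) • a ν := by
  have hmem : ∀ y : (Σ i, Fin (β i + 1)) → ℕ,
      (fun i => stepPoints (β i) fun a => (y ⟨i, a⟩ : ℤ_[p])) ∈ diffQuotSet p β := by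
    refine fun y => mem_diffQuotSet_of_injective fun i => ?_
    rw [stepPoints_natCast (β i) fun a => y ⟨i, a⟩]
    exact Nat.cast_injective.comp (stepPoints_injective _ _)
  have h1 : HasSum (fun μ : Fin n → ℕ => newtonCoeff (fun y : (Σ i, Fin (β i + 1)) → ℕ =>
      (∏ i, chooseDividedDiff p (β i) (μ i) (stepPoints (β i) fun a => (y ⟨i, a⟩ : ℤ_[p]))) • a μ)
      (fun s => l s.1 s.2))
      (newtonCoeff (fun y : (Σ i, Fin (β i + 1)) → ℕ =>
        diffQuot f β fun i => stepPoints (β i) fun a => (y ⟨i, a⟩ : ℤ_[p]))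
        (fun s => l s.1 s.2)) :=
    -- A Newton coefficient is a finite sum of values, so it may be taken termwise.
    hasSum_sum fun y _ => (hasSum_diffQuot hf (hmem y)).const_smul _
  refine h1.unique ?_
  have h2 : ∀ μ : Fin n → ℕ, newtonCoeff (fun y : (Σ i, Fin (β i + 1)) → ℕ =>
      (∏ i, chooseDividedDiff p (β i) (μ i) (stepPoints (β i) fun a => (y ⟨i, a⟩ : ℤ_[p]))) • a μ)
      (fun s => l s.1 s.2) = (∏ i, if μ i = ν i then γ i else 0) • a μ := by
    intro μ
    rw [newtonCoeff_smul, newtonCoeff_curry (fun i (y : Fin (β i + 1) → ℕ) =>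
      chooseDividedDiff p (β i) (μ i) (stepPoints (β i) fun a => (y a : ℤ_[p])))]
    exact congrArg (· • a μ) (Finset.prod_congr rfl fun i _ => h i (μ i))
  simp only [h2]
  have h3 := hasSum_single (f := fun μ : Fin n → ℕ =>
    (∏ i, if μ i = ν i then γ i else 0) • a μ) ν fun μ hμ => by
      obtain ⟨i, hi⟩ := Function.ne_iff.1 hμ
      rw [Finset.prod_eq_zero (Finset.mem_univ i) (if_neg hi), zero_smul]
  simpa using h3

/-- The weighted Mahler coefficients of a `C^α`-function tend to zero. -/
theorem IsCAlpha.tendsto_seminorm_mul_multiWeight [Nonempty (Fin n)]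
    {f : (Fin n → ℤ_[p]) → E} {a : (Fin n → ℕ) → E}
    (hf : ∀ x, HasSum (fun ν => (multiChoose x ν : ℚ_[p]) • a ν) (f x))
    {α : Fin n → ℕ} (hα : IsCAlpha α f) {q : Seminorm ℚ_[p] E} (hqc : Continuous q)
    (hq : IsNonarchimedean q) :
    Tendsto (fun ν => q (a ν) * multiWeight α ν) (absAtTop n) (𝓝 0) := by
  choose C hC hstep using fun i : Fin n => exists_stepCoeff_ge (p := p) (α i)
  have hCpos : 0 < ∏ i, C i := Finset.prod_pos fun i _ => hC i
  rw [Metric.tendsto_nhds]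
  intro ε hε
  set Φ : ∀ β : Fin n → ℕ, ((Σ i, Fin (β i + 1)) → ℕ) → E := fun β y =>
    diffQuot f β fun i => stepPoints (β i) fun a => (y ⟨i, a⟩ : ℤ_[p]) with hΦ
  have hev : ∀ β ≤ α, ∃ M : ℕ, ∀ l : (Σ i, Fin (β i + 1)) → ℕ, M ≤ ∑ s, l s →
      q (newtonCoeff (Φ β) l) < ε / ∏ i, C i := by
    intro β hβ
    obtain ⟨g, hg, hgeq⟩ := hα β hβ
    have : Nonempty (Σ i, Fin (β i + 1)) := ⟨⟨Classical.arbitrary _, 0⟩⟩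
    have hcont : Continuous fun y : (Σ i, Fin (β i + 1)) → ℤ_[p] =>
        g fun i => stepPoints (β i) fun a => y ⟨i, a⟩ :=
      hg.comp (continuous_pi fun i => (continuous_stepPoints (β i)).comp
        (continuous_pi fun a => continuous_apply _))
    have ht := (tendsto_seminorm_newtonCoeff hcont hqc hq).eventually
      (gt_mem_nhds (div_pos hε hCpos))
    rw [← comap_sum_atTop, eventually_comap, eventually_atTop] at ht
    obtain ⟨M, hM⟩ := ht
    refine ⟨M, fun l hl => ?_⟩
    have heq : Φ β = fun y : (Σ i, Fin (β i + 1)) → ℕ =>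
        g fun i => stepPoints (β i) fun a => (y ⟨i, a⟩ : ℤ_[p]) := by
      funext y
      refine (hgeq (mem_diffQuotSet_of_injective fun i => ?_)).symm
      rw [stepPoints_natCast (β i) fun a => y ⟨i, a⟩]
      exact Nat.cast_injective.comp (stepPoints_injective _ _)
    rw [heq]
    exact hM _ hl l rfl
  choose! M hM using hev
  rw [absAtTop, eventually_comap]
  -- The order `β` depends on `ν` but ranges over the finite set `β ≤ α`, so one threshold serves
  -- all. The term `∑ i, α i` pays for `|l| = |ν| - |β|`.
  filter_upwards [eventually_ge_atTop (∑ β ∈ Finset.Iic α, M β + ∑ i, α i)] with m hm ν hν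
  choose β hβ l hl γ hγ hcoeff using fun i => hstep i (ν i)
  have hcomp := newtonCoeff_diffQuot_stepPoints hf hcoeff
  have hsum : ∑ s : (Σ i, Fin (β i + 1)), l s.1 s.2 + ∑ i, β i = m := by
    rw [Fintype.sum_sigma, ← Finset.sum_add_distrib, ← hν]
    exact Finset.sum_congr rfl fun i _ => hl i
  have hβsum : ∑ i, β i ≤ ∑ i, α i := Finset.sum_le_sum fun i _ => hβ i
  have hMβ : M β ≤ ∑ β ∈ Finset.Iic α, M β :=
    Finset.single_le_sum (f := M) (fun _ _ => Nat.zero_le _) (Finset.mem_Iic.2 hβ)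
  have hlt := hM β hβ (fun s => l s.1 s.2) (by lia)
  rw [hΦ] at hlt
  simp only at hlt
  rw [hcomp, map_smul_eq_mul, norm_prod, lt_div_iff₀ hCpos] at hlt
  have hw : multiWeight α ν ≤ (∏ i, C i) * ∏ i, ‖γ i‖ := by
    rw [multiWeight, ← Finset.prod_mul_distrib]
    exact Finset.prod_le_prod (fun i _ => by positivity) fun i _ => hγ i
  have hw0 : 0 ≤ multiWeight α ν := Finset.prod_nonneg fun i _ => by positivity
  rw [Real.dist_0_eq_abs, abs_of_nonneg (mul_nonneg (apply_nonneg q _) hw0)]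
  refine (mul_le_mul_of_nonneg_left hw (apply_nonneg q _)).trans_lt (lt_of_eq_of_lt ?_ hlt)
  ring

/-- A function with rapidly decreasing Mahler coefficients is `C^α`. -/
theorem isCAlpha_of_tendsto_seminorm_mul_multiWeight (hE : IsLocallyConvexPadic p E)
    (hseq : ∀ u : ℕ → E, CauchySeq u → ∃ x : E, Tendsto u atTop (𝓝 x))
    {f : (Fin n → ℤ_[p]) → E} {a : (Fin n → ℕ) → E}
    (hf : ∀ x, HasSum (fun ν => (multiChoose x ν : ℚ_[p]) • a ν) (f x)) {α : Fin n → ℕ}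
    (h : ∀ q : Seminorm ℚ_[p] E, Continuous q → IsNonarchimedean q →
      Tendsto (fun ν => q (a ν) * multiWeight α ν) (absAtTop n) (𝓝 0)) :
    IsCAlpha α f := by
  intro β hβ
  obtain ⟨g, hg, hsum⟩ := exists_continuous_hasSum_smul hE hseq (a := a) (B := multiWeight α)
    (T := fun ν (x : DiffQuotDomain p β) => ∏ i, chooseDividedDiff p (β i) (ν i) (x i))
    (fun ν => continuous_finsetProd _ fun i _ =>
      (continuous_chooseDividedDiff (β i) (ν i)).comp (continuous_apply i))
    (fun ν x => by
      rw [norm_prod]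
      refine Finset.prod_le_prod (fun i _ => norm_nonneg _) fun i _ =>
        (norm_chooseDividedDiff_le _ _ _).trans (pow_le_pow_right₀ ?_ (hβ i))
      exact_mod_cast le_max_right _ _)
    (fun q hqc hq => absAtTop_eq_cofinite n ▸ h q hqc hq)
  exact ⟨g, hg, fun x hx => (hsum x).unique (hasSum_diffQuot hf hx)⟩

end

/-! ### Comparison of weights for (iii), and the main theorem. -/

lemma multiWeight_le_sum_pow {n : ℕ} {α ν : Fin n → ℕ} {r : ℕ} (hα : ∑ i, α i ≤ r)
    (hν : 1 ≤ ∑ i, ν i) : multiWeight α ν ≤ ((∑ i, ν i : ℕ) : ℝ) ^ r := by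
  have h1 : (1 : ℝ) ≤ ((∑ i, ν i : ℕ) : ℝ) := by exact_mod_cast hν
  refine le_trans ?_ (pow_le_pow_right₀ h1 hα)
  rw [← Finset.prod_pow_eq_pow_sum, multiWeight]
  refine Finset.prod_le_prod (fun i _ => by positivity) fun i _ => ?_
  gcongr
  exact max_le (Finset.single_le_sum (fun _ _ => Nat.zero_le _) (Finset.mem_univ i)) hν

/-- The power mean inequality: the pure powers of single coordinates already control `|ν|`. -/
lemma sum_pow_le_mul_sum_multiWeight {n : ℕ} (ν : Fin n → ℕ) (r : ℕ) :
    ((∑ i, ν i : ℕ) : ℝ) ^ (r + 1) ≤ (n : ℝ) ^ r * ∑ i, multiWeight (Pi.single i (r + 1)) ν := by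
  rcases Nat.eq_zero_or_pos n with rfl | hn
  · simp
  have hw : ∀ i : Fin n, multiWeight (Pi.single i (r + 1)) ν =
      ((max (ν i) 1 : ℕ) : ℝ) ^ (r + 1) := by
    intro i
    rw [multiWeight, Finset.prod_eq_single i (fun k _ hk => by simp [hk]) (by simp),
      Pi.single_eq_same]
  have h := pow_sum_div_card_le_sum_pow (s := Finset.univ) (f := fun i => (ν i : ℝ))
    (fun i _ => Nat.cast_nonneg _) r
  rw [Finset.card_univ, Fintype.card_fin,
    div_le_iff₀' (pow_pos (by exact_mod_cast hn) r)] at h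
  push_cast
  refine h.trans (mul_le_mul_of_nonneg_left (Finset.sum_le_sum fun i _ => ?_) (by positivity))
  rw [hw]
  gcongr
  exact le_max_left _ _

section

variable {p : ℕ} [Fact p.Prime] {n : ℕ} {E : Type*} [AddCommGroup E] [Module ℚ_[p] E]

lemma tendsto_mul_sum_pow_iff (q : Seminorm ℚ_[p] E) (a : (Fin n → ℕ) → E) (r : ℕ) :
    Tendsto (fun ν => q (a ν) * ((∑ i, ν i : ℕ) : ℝ) ^ r) (absAtTop n) (𝓝 0) ↔
      ∀ α : Fin n → ℕ, ∑ i, α i ≤ r →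
        Tendsto (fun ν => q (a ν) * multiWeight α ν) (absAtTop n) (𝓝 0) := by
  refine ⟨fun h α hα => ?_, fun h => ?_⟩
  · have h1 : ∀ᶠ ν in absAtTop n, 1 ≤ ∑ i, ν i :=
      (eventually_ge_atTop 1).comap _
    refine squeeze_zero' (Eventually.of_forall fun ν => mul_nonneg (apply_nonneg q _)
      (Finset.prod_nonneg fun i _ => by positivity)) ?_ h
    filter_upwards [h1] with ν hν
    exact mul_le_mul_of_nonneg_left (multiWeight_le_sum_pow hα hν) (apply_nonneg q _)
  · cases r with
    | zero => simpa [multiWeight] using h 0 (by simp)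
    | succ r =>
      have h2 : Tendsto (fun ν => (n : ℝ) ^ r *
          ∑ i, q (a ν) * multiWeight (Pi.single i (r + 1)) ν) (absAtTop n) (𝓝 0) := by
        have := (tendsto_finsetSum Finset.univ fun (i : Fin n) _ =>
          h (Pi.single i (r + 1)) (by simp)).const_mul ((n : ℝ) ^ r)
        simpa using this
      refine squeeze_zero (fun ν => mul_nonneg (apply_nonneg q _) (by positivity)) (fun ν => ?_) h2
      refine (mul_le_mul_of_nonneg_left (sum_pow_le_mul_sum_multiWeight ν r)
        (apply_nonneg q _)).trans (le_of_eq ?_)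
      rw [← Finset.mul_sum]
      ring

end

theorem theoremC (p : ℕ) [Fact p.Prime] (n : ℕ) (hn : 1 ≤ n)
    (E : Type*) [AddCommGroup E] [Module ℚ_[p] E] [UniformSpace E] [IsUniformAddGroup E]
    [ContinuousSMul ℚ_[p] E] [T2Space E]
    (hE : IsLocallyConvexPadic p E)
    (hseq : ∀ u : ℕ → E, CauchySeq u → ∃ x : E, Tendsto u atTop (𝓝 x))
    (f : (Fin n → ℤ_[p]) → E) (hf : Continuous f) :
    (∀ x : Fin n → ℤ_[p],
      HasSum (fun ν : Fin n → ℕ => (multiChoose x ν : ℚ_[p]) • mahlerCoeff f ν) (f x)) ∧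
    (∀ α : Fin n → ℕ, IsCAlpha α f ↔
      ∀ q : Seminorm ℚ_[p] E, Continuous q → IsNonarchimedean q →
        Tendsto (fun ν => q (mahlerCoeff f ν) * multiWeight α ν) (absAtTop n) (𝓝 0)) ∧
    (∀ r : ℕ, IsCr r f ↔
      ∀ q : Seminorm ℚ_[p] E, Continuous q → IsNonarchimedean q →
        Tendsto (fun ν => q (mahlerCoeff f ν) * ((∑ i, ν i : ℕ) : ℝ) ^ r) (absAtTop n) (𝓝 0)) := by
  have : Nonempty (Fin n) := ⟨⟨0, hn⟩⟩
  have hsum := hasSum_multiChoose_smul_mahlerCoeff hE hseq hf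
  have hα : ∀ α : Fin n → ℕ, IsCAlpha α f ↔
      ∀ q : Seminorm ℚ_[p] E, Continuous q → IsNonarchimedean q →
        Tendsto (fun ν => q (mahlerCoeff f ν) * multiWeight α ν) (absAtTop n) (𝓝 0) := fun α =>
    ⟨fun h q hqc hq => h.tendsto_seminorm_mul_multiWeight hsum hqc hq,
      isCAlpha_of_tendsto_seminorm_mul_multiWeight hE hseq hsum⟩
  refine ⟨hsum, hα, fun r => ?_⟩
  simp only [IsCr, hα, tendsto_mul_sum_pow_iff]
  exact ⟨fun h q hqc hq α hr => h α hr q hqc hq, fun h α hr q hqc hq => h q hqc hq α hr⟩
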